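/- Let $q$ be a prime power and let $\mathcal L$ be a set of lines of the affine space $\mathrm{AG}(3,q)$ with $|\mathcal L| = x(q^2+q+1)$, where $x$ is a positive integer. Let $A$ be the point-line incidence matrix of $\mathrm{AG}(3,q)$ over $\mathbb C$ (rows indexed by points, columns by lines), and let $\chi_{\mathcal L}$ be the characteristic vector of $\mathcal L$, so that $\chi_{\mathcal L}(\ell)=1$ if $\ell\in\mathcal L$ and $\chi_{\mathcal L}(\ell)=0$ otherwise. Two lines are disjoint if they have no common point in $\mathrm{AG}(3,q)$. A partial line spread is a set of pairwise disjoint lines; a line spread is a partial line spread whose lines partition the points of $\mathrm{AG}(3,q)$; a pair of conjugated switching sets consists of two partial line spreads that have no line in common and cover the same set of points. A line of $\mathrm{AG}(3,q)$ passes through a point at infinity, i.e. a one-dimensional subspace of $\mathbb F_q^3$, if that subspace is its direction. Then the following properties are equivalent. 1. For every line spread $\mathcal S$ of $\mathrm{AG}(3,q)$, $|\mathcal L\cap\mathcal S|=x$. 2. $\chi_{\mathcal L}\in(\ker A)^\perp$. 3. $\chi_{\mathcal L}\in\operatorname{Im}(A^T)$. 4. For every pair of conjugated switching sets $\mathcal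 R$ and $\mathcal R'$ in $\mathrm{AG}(3,q)$, $|\mathcal L\cap\mathcal R|=|\mathcal L\cap\mathcal R'|$. 5. For every line $\ell$ of $\mathrm{AG}(3,q)$, the number of elements of $\mathcal L$ disjoint from $\ell$ is $(q^2+1)(x-\chi_{\mathcal L}(\ell))$, and through every point at infinity there are exactly $x$ lines of $\mathcal L$. -/

import Mathlib

noncomputable section

namespace AG

/-- The points of `AG(3,q)`, where `K` is the field with `q` elements. -/
abbrev Point (K : Type*) : Type _ := Fin 3 → K

/-- The lines of `AG(3,q)`: the affine subspaces whose direction is one-dimensional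
(the empty affine subspace has direction `⊥`, so it is not one of them). -/
def Line (K : Type*) [Field K] : Type _ :=
  {ℓ : AffineSubspace K (Point K) // Module.finrank K ℓ.direction = 1}

variable {K : Type*} [Field K]

/-- The set of (affine) points on a line. -/
def Line.points (ℓ : Line K) : Set (Point K) := (ℓ.1 : Set (Point K))

theorem Line.points_injective : Function.Injective (Line.points (K := K)) := fun _ _ h =>
  Subtype.ext (SetLike.coe_injective h)

instance [Finite K] : Finite (Line K) := Finite.of_injective _ Line.points_injective

instance [Finite K] : Fintype (Line K) := Fintype.ofFinite _

instance : DecidableEq (Line K) := Classical.decEq _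

/-- Two lines are disjoint if they have no common point in `AG(3,q)`
(they may meet at infinity). -/
def Line.IsDisjoint (ℓ m : Line K) : Prop := Disjoint ℓ.points m.points

/-- The points at infinity of `AG(3,q)`: the points of the plane at infinity `PG(2,q)`,
i.e. the one-dimensional subspaces of the translation space `K³`. -/
abbrev PointAtInfinity (K : Type*) [Field K] : Type _ := Projectivization K (Fin 3 → K)

/-- The affine line `ℓ` passes through the point at infinity `P`
if the direction of `ℓ` is `P`. -/
def Line.PassesThrough (ℓ : Line K) (P : PointAtInfinity K) : Prop :=
  ℓ.1.direction = P.submodule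

/-- A partial line spread: a set of pairwise disjoint lines. -/
def IsPartialLineSpread (S : Set (Line K)) : Prop := S.Pairwise Line.IsDisjoint

/-- The set of points covered by a set of lines. -/
def coveredPoints (S : Set (Line K)) : Set (Point K) := ⋃ ℓ ∈ S, ℓ.points

/-- A line spread: a partial line spread that partitions the points of `AG(3,q)`. -/
def IsLineSpread (S : Set (Line K)) : Prop :=
  IsPartialLineSpread S ∧ coveredPoints S = Set.univ

/-- A pair of conjugated switching sets: two disjoint partial line spreads
that cover the same set of points. -/
def AreConjugatedSwitchingSets (R R' : Set (Line K)) : Prop :=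
  IsPartialLineSpread R ∧ IsPartialLineSpread R' ∧ Disjoint R R' ∧
    coveredPoints R = coveredPoints R'

open Classical in
/-- The point-line incidence matrix of `AG(3,q)` over `ℂ`: rows are indexed by points,
columns by lines. -/
def incidenceMatrix (K : Type*) [Field K] : Matrix (Point K) (Line K) ℂ :=
  Matrix.of fun p ℓ => if p ∈ ℓ.points then 1 else 0

/-- The characteristic vector of a set of lines, with entries in `R`. -/
def charVec (R : Type*) [Zero R] [One R] (L : Set (Line K)) : Line K → R :=
  L.indicator 1

end AG

end

/-! The implications run 2 ↔ 3 → 4 → 1 → 5 → 3. Membership in the image of `Aᵀ` means that some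
weighting `w` of the points has sum `χ_L(ℓ)` on every line `ℓ`. Then `|L ∩ R|` is the total weight
of the points covered by `R`, so conjugated switching sets agree. Two spreads differ by such a pair,
so all spreads meet `L` equally often; averaging over the parallel classes gives `x`.

For 1 → 5, turning the lines of one plane within a parallel class gives another spread, so all
parallel classes of a plane contain equally many lines of `L` (`card_parallelClass_plane_eq`).
Summing over the planes through `ℓ` compares the lines of `L` meeting `ℓ` with those parallel to it,
and there are `x` of the latter, `ℓ` included when it lies in `L`.

For 5 → 3, if `n_p` lines of `L` pass through `p`, the disjointness count makes the sum of `n_p - x`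
over `ℓ` equal to `(q² + q) χ_L(ℓ)`, so rescaling gives a weighting. -/

/-! ### Finite cardinalities and linear algebra. -/

theorem Set.ncard_setOf_eq_card_filter {α : Type*} [Fintype α] (P : α → Prop)
    [DecidablePred P] :
    {a | P a}.ncard = (Finset.univ.filter P).card := by
  rw [← Set.ncard_coe_finset]
  simp

open scoped Classical in
theorem Submodule.card_filter_mem_notMem {K V : Type*} [Field K] [Fintype K] [AddCommGroup V]
    [Module K V] [Fintype V] {U W : Submodule K V} (h : U ≤ W) :
    (Finset.univ.filter fun v : V => v ∈ W ∧ v ∉ U).card =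
      Fintype.card K ^ Module.finrank K W - Fintype.card K ^ Module.finrank K U := by
  have hc : ∀ X : Submodule K V, (Finset.univ.filter fun v : V => v ∈ X).card =
      Fintype.card K ^ Module.finrank K X := fun X => by
    rw [← Module.card_eq_pow_finrank (K := K) (V := X), Fintype.card_subtype]
  rw [← hc, ← hc, ← Finset.card_sdiff_of_subset]
  · congr 1
    ext v
    simp
  · intro v hv
    simp only [Finset.mem_filter, Finset.mem_univ, true_and] at hv ⊢
    exact h hv

/-- Since `v ∉ U`, the coefficient of `w` in `v` is nonzero, so `w` can be solved for. -/
theorem Submodule.sup_span_singleton_exchange {K V : Type*} [Field K] [AddCommGroup V]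
    [Module K V] {U : Submodule K V} {v w : V} (hv : v ∉ U) (h : v ∈ U ⊔ K ∙ w) :
    w ∈ U ⊔ K ∙ v := by
  obtain ⟨u, hu, y, hy, rfl⟩ := Submodule.mem_sup.1 h
  obtain ⟨c, rfl⟩ := Submodule.mem_span_singleton.1 hy
  have hc : c ≠ 0 := by
    rintro rfl
    exact hv (by simpa using hu)
  refine Submodule.mem_sup.2 ⟨-(c⁻¹ • u), U.neg_mem (U.smul_mem _ hu), c⁻¹ • (u + c • w),
    Submodule.smul_mem _ _ (Submodule.mem_span_singleton_self _), ?_⟩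
  rw [smul_add, smul_smul, inv_mul_cancel₀ hc, one_smul, neg_add_cancel_left]

theorem Submodule.finrank_sup_span_singleton_eq_add_one {K V : Type*} [Field K] [AddCommGroup V]
    [Module K V] [FiniteDimensional K V] {U : Submodule K V} {v : V} (hv : v ∉ U) :
    Module.finrank K (U ⊔ K ∙ v : Submodule K V) = Module.finrank K U + 1 := by
  have hv0 : v ≠ 0 := fun h => hv (h ▸ U.zero_mem)
  have h := Submodule.finrank_sup_add_finrank_inf_eq U (K ∙ v)
  have hbot : U ⊓ K ∙ v = ⊥ :=
    disjoint_iff.1 ((Submodule.disjoint_span_singleton' hv0).2 hv)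
  rwa [hbot, finrank_bot, add_zero, finrank_span_singleton hv0] at h

theorem Submodule.eq_span_singleton_of_finrank_eq_one {K V : Type*} [Field K] [AddCommGroup V]
    [Module K V] [FiniteDimensional K V] {U : Submodule K V} (hU : Module.finrank K U = 1) {v : V}
    (hv : v ∈ U) (hv0 : v ≠ 0) : U = K ∙ v :=
  (Submodule.eq_of_le_of_finrank_eq ((Submodule.span_singleton_le_iff_mem v U).2 hv)
    (by rw [hU, finrank_span_singleton hv0])).symm

/-! ### Affine lines, spreads and switching. -/

namespace AG

variable {K : Type*} [Field K]

/-- The direction of a line. -/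
def Line.direction (ℓ : Line K) : Submodule K (Point K) := ℓ.1.direction

theorem Line.finrank_direction (ℓ : Line K) : Module.finrank K ℓ.direction = 1 := ℓ.2

theorem Line.mem_points_iff {ℓ : Line K} {p : Point K} (hp : p ∈ ℓ.points) (r : Point K) :
    r ∈ ℓ.points ↔ r - p ∈ ℓ.direction :=
  ⟨fun hr => AffineSubspace.vsub_mem_direction hr hp, fun h => by
    have := AffineSubspace.vadd_mem_of_mem_direction h hp
    simpa [Line.points] using this⟩

theorem Line.nonempty_points (ℓ : Line K) : ℓ.points.Nonempty := by
  rw [Line.points, Set.nonempty_iff_ne_empty, Ne, AffineSubspace.coe_eq_bot_iff]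
  intro h
  have := ℓ.2
  rw [h, AffineSubspace.direction_bot, finrank_bot] at this
  exact zero_ne_one this

theorem Line.eq_of_direction_eq {ℓ m : Line K} (h : ℓ.direction = m.direction) {p : Point K}
    (hℓ : p ∈ ℓ.points) (hm : p ∈ m.points) : ℓ = m :=
  Subtype.ext (AffineSubspace.ext_of_direction_eq h ⟨p, hℓ, hm⟩)

theorem Line.eq_of_mem_points {ℓ m : Line K} {p r : Point K} (hpr : p ≠ r) (hpℓ : p ∈ ℓ.points)
    (hpm : p ∈ m.points) (hrℓ : r ∈ ℓ.points) (hrm : r ∈ m.points) : ℓ = m := by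
  have hne : r - p ≠ 0 := sub_ne_zero.2 hpr.symm
  refine Line.eq_of_direction_eq ?_ hpℓ hpm
  rw [Submodule.eq_span_singleton_of_finrank_eq_one ℓ.finrank_direction ((Line.mem_points_iff hpℓ r).1 hrℓ) hne,
    Submodule.eq_span_singleton_of_finrank_eq_one m.finrank_direction ((Line.mem_points_iff hpm r).1 hrm) hne]

theorem Line.not_isDisjoint_iff {ℓ m : Line K} :
    ¬ ℓ.IsDisjoint m ↔ ∃ p, p ∈ ℓ.points ∧ p ∈ m.points :=
  Set.not_disjoint_iff

/-- The line through a point in a given direction. -/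
def Line.ofDirection (p : Point K) (D : Submodule K (Point K)) (hD : Module.finrank K D = 1) :
    Line K :=
  ⟨AffineSubspace.mk' p D, by rwa [AffineSubspace.direction_mk']⟩

theorem Line.direction_ofDirection (p : Point K) (D : Submodule K (Point K))
    (hD : Module.finrank K D = 1) : (Line.ofDirection p D hD).direction = D :=
  AffineSubspace.direction_mk' p D

theorem Line.mem_points_ofDirection (p : Point K) (D : Submodule K (Point K))
    (hD : Module.finrank K D = 1) : p ∈ (Line.ofDirection p D hD).points :=
  AffineSubspace.self_mem_mk' p D

/-- A field of directions that is constant along its own lines gives a line spread. -/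
theorem isLineSpread_of_directions (d : Point K → Submodule K (Point K))
    (hd : ∀ p, Module.finrank K (d p) = 1) (hconst : ∀ p r, r - p ∈ d p → d r = d p) :
    IsLineSpread {m : Line K | ∀ p ∈ m.points, m.direction = d p} := by
  constructor
  · intro ℓ hℓ m hm hne
    by_contra h
    obtain ⟨p, hpℓ, hpm⟩ := Line.not_isDisjoint_iff.1 h
    exact hne (Line.eq_of_direction_eq ((hℓ p hpℓ).trans (hm p hpm).symm) hpℓ hpm)
  · refine Set.eq_univ_of_forall fun p => Set.mem_biUnion (x := Line.ofDirection p (d p) (hd p)) ?_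
      (Line.mem_points_ofDirection _ _ _)
    intro r hr
    rw [Line.mem_points_iff (Line.mem_points_ofDirection _ _ _),
      Line.direction_ofDirection] at hr
    rw [Line.direction_ofDirection, hconst p r hr]

theorem isLineSpread_parallelClass (D : Submodule K (Point K)) (hD : Module.finrank K D = 1) :
    IsLineSpread {m : Line K | m.direction = D} := by
  convert isLineSpread_of_directions (fun _ => D) (fun _ => hD) (fun _ _ _ => rfl) using 3 with m
  exact ⟨fun h _ _ => h, fun h => h _ m.nonempty_points.some_mem⟩

open scoped Classical in
/-- In the parallel class of `D`, the lines of the plane `a + W` are switched to direction `D'`. -/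
theorem isLineSpread_switched {D D' W : Submodule K (Point K)} (hD : Module.finrank K D = 1)
    (hD' : Module.finrank K D' = 1) (hDW : D ≤ W) (hDW' : D' ≤ W) (a : Point K) :
    IsLineSpread {m : Line K | ∀ p ∈ m.points, m.direction = if p - a ∈ W then D' else D} := by
  refine isLineSpread_of_directions (fun p => if p - a ∈ W then D' else D) (fun p => ?_) ?_
  · by_cases hp : p - a ∈ W
    · rw [if_pos hp, hD']
    · rw [if_neg hp, hD]
  · intro p r h
    -- Both directions lie in `W`, so moving along either one never enters or leaves the plane.
    have hW : r - p ∈ W := by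
      split_ifs at h
      · exact hDW' h
      · exact hDW h
    have : r - a ∈ W ↔ p - a ∈ W := by
      rw [show r - a = (r - p) + (p - a) by abel]
      exact W.add_mem_iff_right hW
    simp only [this]

/-- A point on a line of `S \ S'` lies on some line of `S'`; that line cannot be in `S`, whose lines
are pairwise disjoint. -/
theorem AreConjugatedSwitchingSets.of_isLineSpread {S S' : Set (Line K)} (hS : IsLineSpread S)
    (hS' : IsLineSpread S') : AreConjugatedSwitchingSets (S \ S') (S' \ S) := by
  have key : ∀ {S S' : Set (Line K)}, IsLineSpread S → IsLineSpread S' →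
      coveredPoints (S \ S') ⊆ coveredPoints (S' \ S) := by
    intro S S' hS hS' p hp
    obtain ⟨ℓ, hℓ, hpℓ⟩ := Set.mem_iUnion₂.1 hp
    have hp' : p ∈ coveredPoints S' := hS'.2 ▸ Set.mem_univ p
    obtain ⟨m, hm, hpm⟩ := Set.mem_iUnion₂.1 hp'
    refine Set.mem_iUnion₂.2 ⟨m, ⟨hm, fun hmS => ?_⟩, hpm⟩
    have : m ≠ ℓ := fun h => hℓ.2 (h ▸ hm)
    exact Set.disjoint_left.1 (hS.1 hmS hℓ.1 this) hpm hpℓ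
  exact ⟨hS.1.mono Set.sdiff_subset, hS'.1.mono Set.sdiff_subset,
    Set.disjoint_left.2 fun _ h h' => h.2 h'.1, (key hS hS').antisymm (key hS' hS)⟩

/-! ### Double counting around a line. -/

variable [Fintype K]

open scoped Classical in
theorem Line.card_points (ℓ : Line K) :
    (Finset.univ.filter fun p : Point K => p ∈ ℓ.points).card = Fintype.card K := by
  obtain ⟨a, ha⟩ := ℓ.nonempty_points
  rw [← pow_one (Fintype.card K), ← ℓ.finrank_direction, ← Module.card_eq_pow_finrank (K := K),
    Fintype.card_subtype]
  refine Finset.card_bij (fun p _ => p - a) ?_ ?_ ?_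
  · intro p hp
    simpa [Line.mem_points_iff ha] using hp
  · intro p _ r _ h
    simpa using h
  · intro v hv
    refine ⟨v + a, ?_, by simp⟩
    simpa [Line.mem_points_iff ha] using hv

open scoped Classical in
/-- Counting the incidences between the points of `ℓ` and the lines of `L`. -/
theorem sum_card_lines_through (L : Set (Line K)) (ℓ : Line K) :
    (∑ p with p ∈ ℓ.points, ((Finset.univ.filter fun m => m ∈ L ∧ p ∈ m.points).card : ℤ)) =
      L.ncard - {m ∈ L | m.IsDisjoint ℓ}.ncard + (Fintype.card K - 1) * charVec ℤ L ℓ := by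
  -- Distinct lines share at most one point; `q - 1` corrects the case `m = ℓ`, where `q` points are
  -- shared.
  have hcount : ∀ m : Line K,
      ((Finset.univ.filter fun p : Point K => p ∈ ℓ.points ∧ p ∈ m.points).card : ℤ) =
        1 - (if m.IsDisjoint ℓ then 1 else 0) +
          (if m = ℓ then (Fintype.card K : ℤ) - 1 else 0) := by
    intro m
    by_cases hm : m = ℓ
    · subst hm
      have : ¬ m.IsDisjoint m := Line.not_isDisjoint_iff.2
        ⟨_, m.nonempty_points.some_mem, m.nonempty_points.some_mem⟩
      simp [this, Line.card_points]
    · by_cases hd : m.IsDisjoint ℓ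
      · have : (Finset.univ.filter fun p : Point K => p ∈ ℓ.points ∧ p ∈ m.points) = ∅ :=
          Finset.filter_eq_empty_iff.2 fun p _ h => Set.disjoint_left.1 hd h.2 h.1
        simp [this, hm, hd]
      · obtain ⟨p, hpm, hpℓ⟩ := Line.not_isDisjoint_iff.1 hd
        have : (Finset.univ.filter fun p : Point K => p ∈ ℓ.points ∧ p ∈ m.points) = {p} := by
          ext r
          simp only [Finset.mem_filter, Finset.mem_univ, true_and, Finset.mem_singleton]
          refine ⟨fun h => ?_, fun h => h ▸ ⟨hpℓ, hpm⟩⟩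
          by_contra hne
          exact hm (Line.eq_of_mem_points hne h.2 h.1 hpm hpℓ)
        simp [this, hm, hd]
  have hdc := Finset.sum_card_bipartiteAbove_eq_sum_card_bipartiteBelow
    (s := Finset.univ.filter fun p : Point K => p ∈ ℓ.points)
    (t := Finset.univ.filter fun m : Line K => m ∈ L) (fun p m => p ∈ m.points)
  simp only [Finset.bipartiteAbove, Finset.bipartiteBelow, Finset.filter_filter] at hdc
  rw [← Nat.cast_sum, hdc, Nat.cast_sum, Finset.sum_congr rfl fun m _ => hcount m,
    Finset.sum_add_distrib, Finset.sum_sub_distrib]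
  have hLc : L.ncard = (Finset.univ.filter fun m : Line K => m ∈ L).card :=
    Set.ncard_setOf_eq_card_filter (· ∈ L)
  rw [hLc, Set.ncard_setOf_eq_card_filter]
  congr 1
  · rw [Finset.sum_const, nsmul_one, Finset.sum_boole, Finset.filter_filter]
  · by_cases h : ℓ ∈ L <;> simp [charVec, h]

open scoped Classical in
-- A plane through `ℓ` is encoded by a vector `w` outside the direction of `ℓ`. Distinct parallels
-- span one plane, leaving `q² - q` choices of `w`; if `m = ℓ`, all `q³ - q` vectors qualify.
theorem card_planes_through {ℓ m : Line K} {a : Point K} (ha : a ∈ ℓ.points)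
    (hm : m.direction = ℓ.direction) :
    (Finset.univ.filter fun w : Point K => w ∉ ℓ.direction ∧
      ∃ p ∈ m.points, p - a ∈ ℓ.direction ⊔ K ∙ w).card =
      Fintype.card K ^ (if m = ℓ then 3 else 2) - Fintype.card K := by
  split_ifs with h
  · subst h
    have := Submodule.card_filter_mem_notMem (le_top : m.direction ≤ ⊤)
    rw [m.finrank_direction, finrank_top, Module.finrank_fin_fun, pow_one] at this
    rw [← this]
    congr 1
    ext w
    simp only [Finset.mem_filter, Finset.mem_univ, true_and, Submodule.mem_top,
      and_iff_left_iff_imp]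
    exact fun _ => ⟨a, ha, by simp⟩
  · obtain ⟨p, hp⟩ := m.nonempty_points
    have hpa : p - a ∉ ℓ.direction := fun h' =>
      h (Line.eq_of_direction_eq hm hp ((Line.mem_points_iff ha p).2 h'))
    have := Submodule.card_filter_mem_notMem
      (le_sup_left : ℓ.direction ≤ ℓ.direction ⊔ K ∙ (p - a))
    rw [Submodule.finrank_sup_span_singleton_eq_add_one hpa, ℓ.finrank_direction, pow_one] at this
    rw [← this]
    congr 1
    ext w
    simp only [Finset.mem_filter, Finset.mem_univ, true_and]
    refine ⟨fun ⟨hw, r, hr, h'⟩ => ⟨?_, hw⟩, fun ⟨h', hw⟩ =>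
      ⟨hw, p, hp, Submodule.sup_span_singleton_exchange hw h'⟩⟩
    refine Submodule.sup_span_singleton_exchange hpa ?_
    have hrp : r - p ∈ ℓ.direction := hm ▸ (Line.mem_points_iff hp r).1 hr
    rw [show p - a = (r - a) - (r - p) by abel]
    exact Submodule.sub_mem _ h' (Submodule.mem_sup_left hrp)

open scoped Classical in
-- Distinct meeting lines are not parallel, so their directions share only `0`.
theorem card_direction_diff {ℓ m : Line K} (hne : m ≠ ℓ) (hm : ¬ m.IsDisjoint ℓ) :
    (Finset.univ.filter fun w : Point K => w ∉ ℓ.direction ∧ w ∈ m.direction).card =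
      Fintype.card K - 1 := by
  obtain ⟨p, hpm, hpℓ⟩ := Line.not_isDisjoint_iff.1 hm
  have := Submodule.card_filter_mem_notMem (bot_le : ⊥ ≤ m.direction)
  rw [m.finrank_direction, finrank_bot, pow_one, pow_zero] at this
  rw [← this]
  congr 1
  ext w
  simp only [Finset.mem_filter, Finset.mem_univ, true_and, Submodule.mem_bot]
  refine ⟨fun h => ⟨h.2, fun h0 => h.1 (h0 ▸ Submodule.zero_mem _)⟩,
    fun h => ⟨fun hw => hne ?_, h.1⟩⟩
  refine Line.eq_of_direction_eq ?_ hpm hpℓ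
  rw [Submodule.eq_span_singleton_of_finrank_eq_one m.finrank_direction h.1 h.2,
    Submodule.eq_span_singleton_of_finrank_eq_one ℓ.finrank_direction hw h.2]

open scoped Classical in
/-- Two parallel classes of lines of a plane contain equally many lines of `L`. -/
theorem card_parallelClass_plane_eq {L : Set (Line K)} {x : ℕ}
    (h : ∀ S : Set (Line K), IsLineSpread S → (L ∩ S).ncard = x)
    {D D' W : Submodule K (Point K)} (hD : Module.finrank K D = 1)
    (hD' : Module.finrank K D' = 1) (hDW : D ≤ W) (hDW' : D' ≤ W) (a : Point K) :
    (Finset.univ.filter fun m : Line K =>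
      m ∈ L ∧ m.direction = D' ∧ ∃ p ∈ m.points, p - a ∈ W).card =
    (Finset.univ.filter fun m : Line K =>
      m ∈ L ∧ m.direction = D ∧ ∃ p ∈ m.points, p - a ∈ W).card := by
  have hall : ∀ m : Line K, m.direction ≤ W → (∃ p ∈ m.points, p - a ∈ W) →
      ∀ r ∈ m.points, r - a ∈ W := by
    rintro m hm ⟨p, hp, hpW⟩ r hr
    rw [show r - a = (r - p) + (p - a) by abel]
    exact W.add_mem (hm ((Line.mem_points_iff hp r).1 hr)) hpW
  have h1 := h _ (isLineSpread_parallelClass D hD)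
  have h2 := h _ (isLineSpread_switched hD hD' hDW hDW' a)
  rw [Set.inter_def, Set.ncard_setOf_eq_card_filter,
    ← Finset.card_filter_add_card_filter_not (fun m : Line K => ∃ p ∈ m.points, p - a ∈ W),
    Finset.filter_filter, Finset.filter_filter] at h1 h2
  -- Off the plane the two spreads coincide, so their counts inside the plane must agree.
  have e : (Finset.univ.filter fun m : Line K => (m ∈ L ∧ m ∈ {m : Line K | m.direction = D}) ∧
        ¬ ∃ p ∈ m.points, p - a ∈ W) =
      Finset.univ.filter fun m : Line K => (m ∈ L ∧ m ∈ {m : Line K | ∀ p ∈ m.points,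
        m.direction = if p - a ∈ W then D' else D}) ∧ ¬ ∃ p ∈ m.points, p - a ∈ W := by
    ext m
    simp only [Finset.mem_filter, Finset.mem_univ, true_and, Set.mem_ofPred_eq]
    refine and_congr_left fun hW => and_congr_right fun _ => ⟨fun hm p hp => ?_, fun hm => ?_⟩
    · rw [if_neg fun hpW => hW ⟨p, hp, hpW⟩, hm]
    · obtain ⟨p, hp⟩ := m.nonempty_points
      rw [hm p hp, if_neg fun hpW => hW ⟨p, hp, hpW⟩]
  have e' : (Finset.univ.filter fun m : Line K => (m ∈ L ∧ m ∈ {m : Line K | ∀ p ∈ m.points,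
        m.direction = if p - a ∈ W then D' else D}) ∧ ∃ p ∈ m.points, p - a ∈ W) =
      Finset.univ.filter fun m : Line K =>
        m ∈ L ∧ m.direction = D' ∧ ∃ p ∈ m.points, p - a ∈ W := by
    ext m
    simp only [Finset.mem_filter, Finset.mem_univ, true_and, Set.mem_ofPred_eq, and_assoc]
    refine and_congr_right fun _ => and_congr_left fun hW => ⟨fun hm => ?_, fun hm p hp => ?_⟩
    · obtain ⟨p, hp, hpW⟩ := hW
      rw [hm p hp, if_pos hpW]
    · rw [if_pos (hall m (hm ▸ hDW') hW p hp), hm]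
  rw [e'] at h2
  rw [e] at h1
  simp only [Set.mem_ofPred_eq, and_assoc] at h1 h2
  omega

open scoped Classical in
theorem ncard_isDisjoint_of_forall_isLineSpread {L : Set (Line K)} {x : ℕ}
    (hL : L.ncard = x * (Fintype.card K ^ 2 + Fintype.card K + 1))
    (h : ∀ S : Set (Line K), IsLineSpread S → (L ∩ S).ncard = x) (ℓ : Line K) :
    ({m ∈ L | m.IsDisjoint ℓ}.ncard : ℤ) =
      ((Fintype.card K : ℤ) ^ 2 + 1) * (x - charVec ℤ L ℓ) := by
  obtain ⟨a, ha⟩ := ℓ.nonempty_points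
  set q := Fintype.card K with hq
  have hq1 : 1 < q := Fintype.one_lt_card
  set s := Finset.univ.filter fun w : Point K => w ∉ ℓ.direction with hs
  have hself : ¬ ℓ.IsDisjoint ℓ := Line.not_isDisjoint_iff.2 ⟨a, ha, ha⟩
  have hA := Finset.sum_card_bipartiteAbove_eq_sum_card_bipartiteBelow (s := s)
    (t := Finset.univ.filter fun m : Line K => m ∈ L ∧ ¬ m.IsDisjoint ℓ ∧ m ≠ ℓ)
    (fun w m => w ∈ m.direction)
  have hB := Finset.sum_card_bipartiteAbove_eq_sum_card_bipartiteBelow (s := s)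
    (t := Finset.univ.filter fun m : Line K => m ∈ L ∧ m.direction = ℓ.direction)
    (fun w m => ∃ p ∈ m.points, p - a ∈ ℓ.direction ⊔ K ∙ w)
  -- In the plane through `ℓ` containing direction `w`, the lines of direction `w` are exactly those
  -- that meet `ℓ` and have `w` in their direction.
  have hAB : ∀ w ∈ s,
      ((Finset.univ.filter fun m : Line K => m ∈ L ∧ ¬ m.IsDisjoint ℓ ∧ m ≠ ℓ).bipartiteAbove
        (fun w m => w ∈ m.direction) w).card =
      ((Finset.univ.filter fun m : Line K => m ∈ L ∧ m.direction = ℓ.direction).bipartiteAbove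
        (fun w m => ∃ p ∈ m.points, p - a ∈ ℓ.direction ⊔ K ∙ w) w).card := by
    intro w hw
    have hw : w ∉ ℓ.direction := by simpa [hs] using hw
    have hw0 : w ≠ 0 := fun h0 => hw (h0 ▸ Submodule.zero_mem _)
    have := card_parallelClass_plane_eq h ℓ.finrank_direction (finrank_span_singleton hw0)
      (le_sup_left : ℓ.direction ≤ ℓ.direction ⊔ K ∙ w) le_sup_right a
    simp only [Finset.bipartiteAbove, Finset.filter_filter, and_assoc]
    rw [← this]
    congr 1
    ext m
    simp only [Finset.mem_filter, Finset.mem_univ, true_and]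
    refine and_congr_right fun _ => ⟨?_, ?_⟩
    · rintro ⟨hd, _, hwm⟩
      obtain ⟨p, hpm, hpℓ⟩ := Line.not_isDisjoint_iff.1 hd
      exact ⟨Submodule.eq_span_singleton_of_finrank_eq_one m.finrank_direction hwm hw0, p, hpm,
        Submodule.mem_sup_left ((Line.mem_points_iff ha p).1 hpℓ)⟩
    · rintro ⟨hm, p, hp, hpa⟩
      have hwm : w ∈ m.direction := hm ▸ Submodule.mem_span_singleton_self w
      refine ⟨Line.not_isDisjoint_iff.2 ?_, fun h => hw (h ▸ hwm), hwm⟩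
      obtain ⟨u, hu, y, hy, huy⟩ := Submodule.mem_sup.1 hpa
      -- With `p - a = u + y`, moving from `p` by `-y` along `m` reaches the point `u + a` of `ℓ`.
      refine ⟨u + a, (Line.mem_points_iff hp _).2 ?_, (Line.mem_points_iff ha _).2 (by simpa)⟩
      rw [hm, show u + a - p = -y by rw [← sub_eq_iff_eq_add'.2 huy.symm]; abel]
      exact Submodule.neg_mem _ hy
  rw [Finset.sum_congr rfl hAB, hB] at hA
  simp only [Finset.bipartiteBelow, hs, Finset.filter_filter] at hA
  rw [Finset.sum_congr rfl fun m hm => card_planes_through ha (Finset.mem_filter.1 hm).2.2,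
    Finset.sum_congr rfl fun m hm => card_direction_diff (Finset.mem_filter.1 hm).2.2.2
      (Finset.mem_filter.1 hm).2.2.1, Finset.sum_const, smul_eq_mul] at hA
  have hpar : (Finset.univ.filter fun m : Line K =>
      m ∈ L ∧ m.direction = ℓ.direction).card = x := by
    rw [← Set.ncard_setOf_eq_card_filter]
    exact h _ (isLineSpread_parallelClass _ ℓ.finrank_direction)
  have hsum : ((∑ m with m ∈ L ∧ m.direction = ℓ.direction,
      (q ^ (if m = ℓ then 3 else 2) - q) : ℕ) : ℤ) =
        x * ((q : ℤ) ^ 2 - q) + ((q : ℤ) ^ 3 - q ^ 2) * charVec ℤ L ℓ := by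
    have : ∀ m : Line K, ((q ^ (if m = ℓ then 3 else 2) - q : ℕ) : ℤ) =
        ((q : ℤ) ^ 2 - q) + if m = ℓ then (q : ℤ) ^ 3 - q ^ 2 else 0 := by
      intro m
      split_ifs
      · rw [Nat.cast_sub (Nat.le_self_pow (by norm_num) q)]
        push_cast
        ring
      · rw [Nat.cast_sub (Nat.le_self_pow (by norm_num) q)]
        push_cast
        ring
    rw [Nat.cast_sum, Finset.sum_congr rfl fun m _ => this m, Finset.sum_add_distrib,
      Finset.sum_const, hpar, nsmul_eq_mul]
    congr 1
    by_cases hℓ : ℓ ∈ L <;> simp [charVec, hℓ]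
  rw [hA, ← hq] at hsum
  push_cast [Nat.cast_sub hq1.le] at hsum
  have hpart : L.ncard = {m ∈ L | m.IsDisjoint ℓ}.ncard +
      ((Finset.univ.filter fun m : Line K => m ∈ L ∧ ¬ m.IsDisjoint ℓ ∧ m ≠ ℓ).card +
        (Finset.univ.filter fun m : Line K => m ∈ L ∧ m = ℓ).card) := by
    rw [show L.ncard = _ from Set.ncard_setOf_eq_card_filter (· ∈ L),
      Set.ncard_setOf_eq_card_filter,
      ← Finset.card_filter_add_card_filter_not fun m : Line K => m.IsDisjoint ℓ,
      Finset.filter_filter, Finset.filter_filter,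
      ← Finset.card_filter_add_card_filter_not
        (s := Finset.univ.filter fun m => m ∈ L ∧ ¬ m.IsDisjoint ℓ) fun m : Line K => m ≠ ℓ,
      Finset.filter_filter, Finset.filter_filter]
    congr 3
    · simp only [and_assoc]
    · ext m
      simp only [Finset.mem_filter, Finset.mem_univ, true_and, not_not, and_assoc]
      exact and_congr_right fun _ => ⟨fun h => h.2, fun h => ⟨h ▸ hself, h⟩⟩
  have hχ : ((Finset.univ.filter fun m : Line K => m ∈ L ∧ m = ℓ).card : ℤ) = charVec ℤ L ℓ := by
    by_cases hℓ : ℓ ∈ L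
    · have : (Finset.univ.filter fun m : Line K => m ∈ L ∧ m = ℓ) = {ℓ} := by
        ext m
        simp only [Finset.mem_filter, Finset.mem_univ, true_and, Finset.mem_singleton]
        exact ⟨fun h => h.2, fun h => ⟨h ▸ hℓ, h⟩⟩
      simp [this, charVec, hℓ]
    · have : (Finset.univ.filter fun m : Line K => m ∈ L ∧ m = ℓ) = ∅ :=
        Finset.filter_eq_empty_iff.2 fun m _ h => hℓ (h.2 ▸ h.1)
      simp [this, charVec, hℓ]
  rw [hL] at hpart
  have hpart' := congrArg (Nat.cast : ℕ → ℤ) hpart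
  push_cast [hχ] at hpart'
  have hq0 : (q : ℤ) - 1 ≠ 0 := by
    have : (1 : ℤ) < q := by exact_mod_cast hq1
    exact sub_ne_zero.2 this.ne'
  apply mul_left_cancel₀ hq0
  -- `hsum` says that `q x + q² χ_L(ℓ)` lines of `L` other than `ℓ` meet `ℓ`, after division by `q -
  -- 1`; `hpart'` subtracts these and `ℓ` itself from `|L|`.
  linear_combination (1 - (q : ℤ)) * hpart' - hsum

end AG
-- The incidence matrix and point weightings.
namespace AG

variable {K : Type*} [Field K]

theorem conjTranspose_incidenceMatrix :
    (incidenceMatrix K).conjTranspose = (incidenceMatrix K).transpose := by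
  ext ℓ p
  simp only [Matrix.conjTranspose_apply, Matrix.transpose_apply, incidenceMatrix, Matrix.of_apply]
  split_ifs <;> simp

theorem isLineSpread_passesThrough (P : PointAtInfinity K) :
    IsLineSpread {m : Line K | m.PassesThrough P} :=
  isLineSpread_parallelClass P.submodule P.finrank_submodule

variable [Fintype K]

/-- The orthogonal complement of a kernel is the range of the adjoint, which is the transpose
because the entries are real. -/
theorem toLp_mem_orthogonal_ker_iff (f : Line K → ℂ) :
    WithLp.toLp 2 f ∈ (LinearMap.ker (Matrix.toEuclideanLin (incidenceMatrix K)))ᗮ ↔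
      f ∈ LinearMap.range (incidenceMatrix K).transpose.mulVecLin := by
  classical
  rw [LinearMap.orthogonal_ker, ← Matrix.toEuclideanLin_conjTranspose_eq_adjoint,
    conjTranspose_incidenceMatrix]
  constructor
  · rintro ⟨w, hw⟩
    exact ⟨w.ofLp, congrArg WithLp.ofLp hw⟩
  · rintro ⟨w, hw⟩
    exact ⟨WithLp.toLp 2 w, congrArg (WithLp.toLp 2) hw⟩

open scoped Classical in
theorem transpose_incidenceMatrix_mulVec (w : Point K → ℂ) (ℓ : Line K) :
    (incidenceMatrix K).transpose.mulVec w ℓ = ∑ p with p ∈ ℓ.points, w p := by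
  simp only [Matrix.mulVec, dotProduct, Matrix.transpose_apply, incidenceMatrix, Matrix.of_apply,
    ite_mul, one_mul, zero_mul, ← Finset.sum_filter]

open scoped Classical in
/-- A point weighting inducing `χ_L` counts the lines of `L` in a partial spread. -/
theorem ncard_inter_eq_sum_coveredPoints {L : Set (Line K)} {w : Point K → ℂ}
    (hw : (incidenceMatrix K).transpose.mulVec w = charVec ℂ L) {R : Set (Line K)}
    (hR : IsPartialLineSpread R) :
    ((L ∩ R).ncard : ℂ) = ∑ p with p ∈ coveredPoints R, w p := by
  have h1 : ((L ∩ R).ncard : ℂ) = ∑ m with m ∈ R, charVec ℂ L m := by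
    rw [Set.inter_def, Set.ncard_setOf_eq_card_filter]
    simp only [charVec, Set.indicator_apply, Pi.one_apply, Finset.sum_boole, Finset.filter_filter,
      and_comm]
  rw [h1, ← hw, Finset.sum_congr rfl fun m _ => transpose_incidenceMatrix_mulVec w m,
    ← Finset.sum_biUnion]
  · congr 1
    ext p
    simp [coveredPoints]
  · intro ℓ hℓ m hm hne
    rw [Function.onFun, Finset.disjoint_left]
    intro p hp hp'
    simp only [Finset.coe_filter, Finset.mem_univ, true_and, Set.mem_ofPred_eq,
      Finset.mem_filter] at hℓ hm hp hp'
    exact Set.disjoint_left.1 (hR hℓ hm hne) hp hp'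

theorem sum_ncard_parallelClass (L : Set (Line K)) [Fintype (PointAtInfinity K)] :
    L.ncard = ∑ P : PointAtInfinity K, {m ∈ L | m.PassesThrough P}.ncard := by
  classical
  rw [show L.ncard = _ from Set.ncard_setOf_eq_card_filter (· ∈ L),
    Finset.card_eq_sum_card_fiberwise (t := Finset.univ)
      (f := fun m : Line K => Projectivization.mk'' m.direction m.finrank_direction)
      (fun _ _ => Finset.mem_univ _)]
  refine Finset.sum_congr rfl fun P _ => ?_
  rw [Set.ncard_setOf_eq_card_filter, Finset.filter_filter]
  congr 1
  ext m
  simp only [Finset.mem_filter, Finset.mem_univ, true_and]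
  refine and_congr_right fun _ => ⟨?_, fun h => ?_⟩
  · rintro rfl
    exact (Projectivization.submodule_mk'' _ _).symm
  · apply Projectivization.submodule_injective
    rw [Projectivization.submodule_mk'']
    exact h

theorem card_pointAtInfinity :
    Nat.card (PointAtInfinity K) = Fintype.card K ^ 2 + Fintype.card K + 1 := by
  rw [Projectivization.card_of_finrank K (Fin 3 → K) (Module.finrank_fin_fun K),
    Nat.card_eq_fintype_card]
  simp only [Finset.sum_range_succ, Finset.sum_range_zero]
  ring

/-- If all line spreads share equally many lines with `L`, this number is the average
over the parallel classes. -/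
theorem ncard_inter_eq_of_forall_eq {L : Set (Line K)} {x : ℕ}
    (hL : L.ncard = x * (Fintype.card K ^ 2 + Fintype.card K + 1))
    (h : ∀ S S' : Set (Line K), IsLineSpread S → IsLineSpread S' →
      (L ∩ S).ncard = (L ∩ S').ncard) (S : Set (Line K)) (hS : IsLineSpread S) :
    (L ∩ S).ncard = x := by
  have := Fintype.ofFinite (PointAtInfinity K)
  have hsum := sum_ncard_parallelClass L
  have hS' : ∀ P ∈ Finset.univ, {m ∈ L | Line.PassesThrough m P}.ncard = (L ∩ S).ncard :=
    fun P _ => h {m | m.PassesThrough P} S (isLineSpread_passesThrough P) hS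
  rw [Finset.sum_congr rfl hS',
    Finset.sum_const, Finset.card_univ, ← Nat.card_eq_fintype_card, card_pointAtInfinity, hL,
    smul_eq_mul, mul_comm] at hsum
  exact (Nat.eq_of_mul_eq_mul_left (Nat.succ_pos _) hsum).symm

theorem charVec_mem_range_of_ncard_isDisjoint {L : Set (Line K)} {x : ℕ}
    (hL : L.ncard = x * (Fintype.card K ^ 2 + Fintype.card K + 1))
    (h : ∀ ℓ : Line K, ({m ∈ L | m.IsDisjoint ℓ}.ncard : ℤ) =
      ((Fintype.card K : ℤ) ^ 2 + 1) * (x - charVec ℤ L ℓ)) :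
    charVec ℂ L ∈ LinearMap.range (incidenceMatrix K).transpose.mulVecLin := by
  classical
  refine ⟨fun p => (((Finset.univ.filter fun m => m ∈ L ∧ p ∈ m.points).card : ℂ) - x) /
    ((Fintype.card K : ℂ) ^ 2 + Fintype.card K), ?_⟩
  have hq : (Fintype.card K : ℂ) ^ 2 + Fintype.card K ≠ 0 := by
    have : 0 < Fintype.card K ^ 2 + Fintype.card K := Nat.add_pos_right _ Fintype.card_pos
    exact_mod_cast this.ne'
  have hχ : ∀ ℓ, ((charVec ℤ L ℓ : ℤ) : ℂ) = charVec ℂ L ℓ := fun ℓ => by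
    by_cases hℓ : ℓ ∈ L <;> simp [charVec, hℓ]
  ext ℓ
  have hsum := sum_card_lines_through L ℓ
  rw [h ℓ, hL] at hsum
  have hsum' := congrArg (Int.cast : ℤ → ℂ) hsum
  push_cast [hχ] at hsum'
  -- The counts `n_p` sum over `ℓ` to `q x + (q² + q) χ_L(ℓ)`; the shift by `x` at each of the `q`
  -- points removes `q x`.
  rw [Matrix.mulVecLin_apply, transpose_incidenceMatrix_mulVec, ← Finset.sum_div,
    Finset.sum_sub_distrib, hsum', Finset.sum_const, Line.card_points, nsmul_eq_mul,
    div_eq_iff hq]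
  ring

end AG

/-! ### The equivalence. -/

theorem theorem4p1 {K : Type*} [Field K] [Fintype K] (q : ℕ) (hq : Fintype.card K = q)
    (x : ℕ) (hx : 0 < x) (L : Set (AG.Line K)) (hL : L.ncard = x * (q ^ 2 + q + 1)) :
    List.TFAE [
      ∀ S : Set (AG.Line K), AG.IsLineSpread S → (L ∩ S).ncard = x,
      WithLp.toLp 2 (AG.charVec ℂ L) ∈
        (LinearMap.ker (Matrix.toEuclideanLin (AG.incidenceMatrix K)))ᗮ,
      AG.charVec ℂ L ∈ LinearMap.range (AG.incidenceMatrix K).transpose.mulVecLin,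
      ∀ R R' : Set (AG.Line K), AG.AreConjugatedSwitchingSets R R' →
        (L ∩ R).ncard = (L ∩ R').ncard,
      (∀ ℓ : AG.Line K,
        (({m ∈ L | m.IsDisjoint ℓ}.ncard : ℕ) : ℤ) =
          ((q : ℤ) ^ 2 + 1) * ((x : ℤ) - AG.charVec ℤ L ℓ)) ∧
      (∀ P : AG.PointAtInfinity K, {m ∈ L | m.PassesThrough P}.ncard = x)] := by
  subst hq
  tfae_have 2 ↔ 3 := AG.toLp_mem_orthogonal_ker_iff _
  tfae_have 3 → 4 := by
    rintro ⟨w, hw⟩ R R' ⟨hR, hR', -, hcov⟩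
    have h1 := AG.ncard_inter_eq_sum_coveredPoints hw hR
    rw [hcov, ← AG.ncard_inter_eq_sum_coveredPoints hw hR'] at h1
    exact_mod_cast h1
  tfae_have 4 → 1 := by
    intro h
    refine AG.ncard_inter_eq_of_forall_eq hL fun S S' hS hS' => ?_
    have hd := h _ _ (AG.AreConjugatedSwitchingSets.of_isLineSpread hS hS')
    -- The lines common to `S` and `S'` contribute equally to both sides.
    rw [← Set.ncard_inter_add_ncard_sdiff_eq_ncard (L ∩ S) S',
      ← Set.ncard_inter_add_ncard_sdiff_eq_ncard (L ∩ S') S, Set.inter_sdiff_assoc,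
      Set.inter_sdiff_assoc, hd, Set.inter_right_comm]
  tfae_have 1 → 5 := fun h =>
    ⟨AG.ncard_isDisjoint_of_forall_isLineSpread hL h,
      fun P => h _ (AG.isLineSpread_passesThrough P)⟩
  tfae_have 5 → 3 := fun h => AG.charVec_mem_range_of_ncard_isDisjoint hL h.1
  tfae_finish
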